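/- Let $(R,\mathfrak m)$ be a one-dimensional Noetherian local domain with infinite residue field $k$ and fraction field $K$. Assume that the integral closure $\overline R$ of $R$ in $K$ is a finite $R$-module and a discrete valuation ring (i.e. $R$ is analytically irreducible), and that $R$ is residually rational, i.e. the natural map from $k$ to the residue field of $\overline R$ is an isomorphism. For fractional ideals $F,G$ of $R$ put $F:G=\{x\in K \mid xG\subseteq F\}$. Let $$\Lambda=\bigcup_{n\ge 0}(\mathfrak m^n:\mathfrak m^n)$$ be the blowing-up of $R$ along $\mathfrak m$, and suppose that $\mathfrak m$ is stable, i.e. $\Lambda=\mathfrak m:\mathfrak m$. Then the following are equivalent: 1. $R$ is almost Gorenstein, i.e. $\mathfrak m=\mathfrak m\,\omega$, where $\omega$ is a canonical ideal of $R$ with $R\subseteq\omega\subseteq\overline R$ (a canonical ideal is a nonzero fractional ideal $\omega$ with $\omega:(\omega:J)=J$ for every nonzero fractional ideal $J$ of $R$; a canonical ideal with $R\subseteq\omega\subseteq\overline R$ exists, and the condition $\mathfrak m=\mathfrak m\,\omega$ does not depend on its choice); 2. $\Lambda$ is Gorenstein, i.e. a Noetherian local ring of finite injective dimension over itself. -/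

import Mathlib

open IsLocalRing
open scoped nonZeroDivisors

/-- A Gorenstein local ring: a Noetherian local ring of finite injective dimension as a module
over itself. -/
def IsGorensteinLocalRing (A : Type*) [CommRing A] : Prop :=
  IsNoetherianRing A ∧ IsLocalRing A ∧
    ∃ n : ℕ, CategoryTheory.HasInjectiveDimensionLE (ModuleCat.of A A) n

section

variable (R : Type*) [CommRing R] (K : Type*) [Field K] [Algebra R K]

/-- `x ∈ A : A` implies `x ∈ AB : AB`. -/
theorem mem_div_self_mul {A : Submodule R K} (B : Submodule R K) {x : K} (hx : x ∈ A / A) :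
    x ∈ (A * B) / (A * B) := by
  rw [Submodule.mem_div_iff_forall_mul_mem] at hx ⊢
  intro y hy
  induction hy using Submodule.mul_induction_on' with
  | mem_mul_mem a ha b hb => rw [← mul_assoc]; exact Submodule.mul_mem_mul (hx a ha) hb
  | add y _ z _ hy hz => rw [mul_add]; exact add_mem hy hz

/-- The blowing-up `Λ(I) = ⋃ₙ (Iⁿ : Iⁿ)` of `R` along `I`, where the colon is taken in `K`
(`F / G = {x : K | x G ⊆ F}` for submodules `F`, `G` of `K`). -/
def blowUp (I : Ideal R) : Subalgebra R K where
  carrier := {x | ∃ n : ℕ,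
    x ∈ IsLocalization.coeSubmodule K I ^ n / IsLocalization.coeSubmodule K I ^ n}
  mul_mem' := by
    rintro x y ⟨n, hx⟩ ⟨m, hy⟩
    refine ⟨n + m, ?_⟩
    have hx' := mem_div_self_mul R K (IsLocalization.coeSubmodule K I ^ m) hx
    have hy' := mem_div_self_mul R K (IsLocalization.coeSubmodule K I ^ n) hy
    rw [← pow_add] at hx' hy'
    rw [add_comm m n] at hy'
    rw [Submodule.mem_div_iff_forall_mul_mem] at hx' hy' ⊢
    intro z hz
    rw [mul_assoc]
    exact hx' _ (hy' z hz)
  add_mem' := by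
    rintro x y ⟨n, hx⟩ ⟨m, hy⟩
    refine ⟨n + m, ?_⟩
    have hx' := mem_div_self_mul R K (IsLocalization.coeSubmodule K I ^ m) hx
    have hy' := mem_div_self_mul R K (IsLocalization.coeSubmodule K I ^ n) hy
    rw [← pow_add] at hx' hy'
    rw [add_comm m n] at hy'
    exact add_mem hx' hy'
  algebraMap_mem' := fun r => ⟨0, by
    rw [Submodule.mem_div_iff_forall_mul_mem]
    intro y hy
    rw [← Algebra.smul_def]
    exact Submodule.smul_mem _ r hy⟩

/-- The maximal ideal `𝔪` of a local ring is stable if `Λ(𝔪) = 𝔪 : 𝔪`. -/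
def IsStableMaximalIdeal [IsLocalRing R] : Prop :=
  Subalgebra.toSubmodule (blowUp R K (maximalIdeal R)) =
    IsLocalization.coeSubmodule K (maximalIdeal R) /
      IsLocalization.coeSubmodule K (maximalIdeal R)

variable {R K} in
/-- A canonical (fractional) ideal of a one-dimensional Noetherian local domain `R` with fraction
field `K`: a nonzero fractional ideal `ω` such that `ω : (ω : J) = J` for every nonzero
fractional ideal `J`. -/
def IsCanonicalIdeal [IsDomain R] [IsFractionRing R K] (ω : FractionalIdeal R⁰ K) : Prop :=
  ω ≠ 0 ∧ ∀ J : FractionalIdeal R⁰ K, J ≠ 0 → ω / (ω / J) = J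

/-- `R` is almost Gorenstein if `𝔪 = 𝔪 ω`, where `ω` is a canonical ideal normalized by
`R ⊆ ω ⊆ R̄`, with `R̄` the integral closure of `R` in `K`.  (Two such `ω` differ by a unit of
`R̄`, so that the condition does not depend on the choice.) -/
def IsAlmostGorenstein [IsDomain R] [IsLocalRing R] [IsFractionRing R K] : Prop :=
  ∃ ω : FractionalIdeal R⁰ K, IsCanonicalIdeal ω ∧ 1 ≤ ω ∧
    (ω : Submodule R K) ≤ Subalgebra.toSubmodule (integralClosure R K) ∧
    (maximalIdeal R : FractionalIdeal R⁰ K) = (maximalIdeal R : FractionalIdeal R⁰ K) * ω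

end

/-! Write S for the blowing-up Λ and R̄ for the integral closure. If x ∈ 𝔪 has least value in R̄,
stability gives 𝔪 = xS, the relation on which both directions rest (`MaximalIdealEqMul`). As K/S is
divisible, dimension shifting shows that S has finite injective dimension iff K/S is injective
(`exists_hasInjectiveDimensionLE_iff_baer`).

If K/S is injective, the socle of S/xS is generated by one element s (`mem_sup_span_of_baer`). If s
∈ R, then 𝔪 is principal. Otherwise let ω be an R-submodule of S maximal among those containing 1
and not s. Then S/ω is simple over R, and an ideal of S inside ω lies in xS = 𝔪, since otherwise it
would force s ∈ ω. These two facts make ω canonical (`MaximalIdealEqMul.isCanonicalIdeal`), and 𝔪ω ⊆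
𝔪S = 𝔪.

Conversely, 𝔪ω = 𝔪 gives xω ⊆ xS, so ω ⊆ S. If ω = S, then S = R and 𝔪 = xR. Otherwise duality into
ω shows that S/ω is simple and ω : S ⊆ 𝔪. A map from the maximal ideal of S to K/S, corrected to
kill x, has values in x⁻¹S/S ≅ S/𝔪. Modulo ω, duality realizes it as a multiplication, and ω : S ⊆ 𝔪
lifts this back to K/S (`MaximalIdealEqMul.exists_eq_mkQ_mul`). -/

/-! ### Baer's criterion and divisible modules in dimension one -/

section DivisibleModules

universe u

variable {A : Type u} [CommRing A]

/-- A linear map on a submodule extends to the submodule generated by one more element `z` as soon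
as a compatible image `e` of `z` is given. -/
theorem LinearMap.exists_extend_sup_span_singleton {M X : Type*} [AddCommGroup M] [Module A M]
    [AddCommGroup X] [Module A X] {N : Submodule A M} (g : N →ₗ[A] X) (z : M) (e : X)
    (H : ∀ (c : A) (h : c • z ∈ N), g ⟨c • z, h⟩ = c • e) :
    ∃ g' : ↥(N ⊔ Submodule.span A {z}) →ₗ[A] X,
      (∀ (i : M) (hi : i ∈ N) (hi' : i ∈ N ⊔ Submodule.span A {z}), g' ⟨i, hi'⟩ = g ⟨i, hi⟩) ∧
      ∀ hz : z ∈ N ⊔ Submodule.span A {z}, g' ⟨z, hz⟩ = e := by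
  let f₁ : M →ₗ.[A] X := ⟨N, g⟩
  let f₂ : M →ₗ.[A] X := LinearPMap.mkSpanSingleton' z e fun c hc => by
    have h := H c (by simp [hc])
    rw [RingHom.id_apply, ← h]
    exact (congrArg g (Subtype.ext hc)).trans (map_zero g)
  have H' : ∀ (x : f₁.domain) (y : f₂.domain), (x : M) = y → f₁ x = f₂ y := by
    rintro ⟨x, hx⟩ ⟨y, hy⟩ (rfl : x = y)
    obtain ⟨c, rfl⟩ := Submodule.mem_span_singleton.mp hy
    exact (H c hx).trans (LinearPMap.mkSpanSingleton'_apply z e _ c hy).symm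
  refine ⟨(f₁.sup f₂ H').toFun, fun i hi hi' => ?_, fun hz => ?_⟩
  · exact ((LinearPMap.left_le_sup f₁ f₂ H').2 (x := ⟨i, hi⟩) (y := ⟨i, hi'⟩) rfl).symm
  · refine ((LinearPMap.right_le_sup f₁ f₂ H').2
      (x := ⟨z, Submodule.mem_span_singleton_self z⟩) (y := ⟨z, hz⟩) rfl).symm.trans ?_
    exact LinearPMap.mkSpanSingleton'_apply_self z e _ _

/-- A homomorphism from an ideal to a module satisfying Baer's criterion is multiplication by an
element. -/
theorem Module.Baer.exists_eq_smul {X : Type*} [AddCommGroup X] [Module A X]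
    (hX : Module.Baer A X) {I : Ideal A} (g : I →ₗ[A] X) :
    ∃ e : X, ∀ a : I, g a = (a : A) • e := by
  obtain ⟨g', hg'⟩ := hX I g
  refine ⟨g' 1, fun a => ?_⟩
  rw [← map_smul, smul_eq_mul, mul_one]
  exact (hg' a a.2).symm

variable [IsDomain A] [IsLocalRing A] [IsNoetherianRing A] [Ring.KrullDimLE 1 A]

/-- Over a one-dimensional Noetherian local domain, the submodule of `M ⧸ N` generated by a nonzero
torsion element has a nonzero socle. -/
theorem exists_smul_notMem_and_maximalIdeal_smul_mem {M : Type*} [AddCommGroup M] [Module A M]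
    (N : Submodule A M) {z : M} (hz : z ∉ N) {r : A} (hr : r ≠ 0) (hrz : r • z ∈ N) :
    ∃ c : A, c • z ∉ N ∧ ∀ a ∈ maximalIdeal A, a • c • z ∈ N := by
  let z' : Submodule.span A {N.mkQ z} := ⟨N.mkQ z, Submodule.mem_span_singleton_self _⟩
  have hz' : z' ≠ 0 := by
    intro h
    exact hz (by simpa [z'] using congrArg Subtype.val h)
  obtain ⟨P, hP, hle⟩ := exists_le_isAssociatedPrime_of_isNoetherianRing A z' hz'
  obtain ⟨hPp, ⟨y, hy⟩, hPy⟩ := isAssociatedPrime_iff.mp hP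
  -- The associated prime contains r ≠ 0, so dimension one forces it to be 𝔪.
  have hrP : r ∈ P := by
    apply hle
    rw [Submodule.mem_colon_singleton, Submodule.mem_bot]
    exact Subtype.ext ((Submodule.Quotient.mk_eq_zero N).mpr hrz)
  have hPm : P = maximalIdeal A :=
    eq_maximalIdeal (hPp.isMaximal_of_ne_bot fun h => hr (by simpa [h] using hrP))
  obtain ⟨c, rfl⟩ := Submodule.mem_span_singleton.mp hy
  have key : ∀ a : A, a ∈ P ↔ a • c • z ∈ N := by
    intro a
    rw [hPy, Submodule.mem_colon_singleton, Submodule.mem_bot, Subtype.ext_iff,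
      ← Submodule.Quotient.mk_eq_zero N]
    rfl
  refine ⟨c, fun h => hPp.ne_top ?_, fun a ha => (key a).mp (hPm ▸ ha)⟩
  rw [Ideal.eq_top_iff_one, key, one_smul]
  exact h

/-- Over a one-dimensional Noetherian local domain, Baer's criterion need only be tested on the
maximal ideal. -/
theorem Module.Baer.of_maximalIdeal {X : Type*} [AddCommGroup X] [Module A X]
    (H : ∀ g : maximalIdeal A →ₗ[A] X, ∃ e : X, ∀ a, g a = (a : A) • e) : Module.Baer A X := by
  have step : ∀ I : Ideal A, I ≠ ⊥ → ∀ g : I →ₗ[A] X,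
      ∃ e : X, ∀ a : I, g a = (a : A) • e := by
    intro I
    induction I using WellFoundedGT.induction with
    | ind I ih =>
    intro hI g
    by_cases htop : I = ⊤
    · subst htop
      refine ⟨g ⟨1, trivial⟩, fun a => ?_⟩
      rw [← map_smul]
      congr 1
      ext
      simp
    obtain ⟨r, hrI, hr⟩ := Submodule.exists_mem_ne_zero_of_ne_bot hI
    obtain ⟨z, hz, hnz⟩ := exists_smul_notMem_and_maximalIdeal_smul_mem I
      (z := (1 : A)) (fun h => htop ((Ideal.eq_top_iff_one I).mpr h)) hr (by simpa using hrI)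
    simp only [smul_eq_mul, mul_one] at hz hnz
    -- Since 𝔪z ⊆ I, the map a ↦ g(az) is defined on 𝔪; its multiplier e is the value to give to z.
    obtain ⟨e, he⟩ := H
      { toFun := fun a => g ⟨a * z, hnz a a.2⟩
        map_add' := fun a b => by
          rw [← map_add]; congr 1; ext; simp [add_mul]
        map_smul' := fun c a => by
          rw [RingHom.id_apply, ← map_smul]; congr 1; ext; simp [mul_assoc] }
    obtain ⟨g', hg', -⟩ := LinearMap.exists_extend_sup_span_singleton g z e fun c hc => by
      have hcm : c ∈ maximalIdeal A := by
        rw [mem_maximalIdeal, mem_nonunits_iff]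
        exact fun hu => hz ((Ideal.unit_mul_mem_iff_mem I hu).mp hc)
      exact he ⟨c, hcm⟩
    have hlt : I < I ⊔ Submodule.span A {z} :=
      lt_of_le_of_ne le_sup_left fun h => hz <| by
        rw [h]; exact Submodule.mem_sup_right (Submodule.mem_span_singleton_self z)
    obtain ⟨e', he'⟩ := ih _ hlt (ne_bot_of_gt hlt) g'
    exact ⟨e', fun a => (hg' a a.2 (hlt.le a.2)).symm.trans (he' ⟨a, hlt.le a.2⟩)⟩
  intro I g
  by_cases hI : I = ⊥
  · subst hI
    refine ⟨0, fun x hx => ?_⟩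
    have : (⟨x, hx⟩ : (⊥ : Ideal A)) = 0 := Subtype.ext ((Submodule.mem_bot A).mp hx)
    rw [this, map_zero, LinearMap.zero_apply]
  · obtain ⟨e, he⟩ := step I hI g
    exact ⟨LinearMap.toSpanSingleton A X e, fun x hx => (he ⟨x, hx⟩).symm⟩

/-- If `X` is a divisible submodule of an injective module and the quotient is injective, then `X`
is injective. -/
theorem Module.Baer.of_injective_of_surjective {X I Y : Type*} [AddCommGroup X] [Module A X]
    [AddCommGroup I] [Module A I] [AddCommGroup Y] [Module A Y]
    (f : X →ₗ[A] I) (p : I →ₗ[A] Y) (hf : Function.Injective f) (hp : Function.Surjective p)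
    (hfp : Function.Exact f p) (hI : Module.Baer A I) (hY : Module.Baer A Y)
    (hX : ∀ a : A, a ≠ 0 → ∀ v : X, ∃ w, a • w = v) : Module.Baer A X := by
  refine Module.Baer.of_maximalIdeal fun g => ?_
  by_cases hbot : maximalIdeal A = ⊥
  · refine ⟨0, fun a => ?_⟩
    have : a = 0 := Subtype.ext ((Submodule.mem_bot A).mp (hbot ▸ a.2))
    rw [this, map_zero, smul_zero]
  obtain ⟨x, hxm, hx⟩ := Submodule.exists_mem_ne_zero_of_ne_bot hbot
  -- The multiplier e lies only in I. The aim is to move it into X without changing its products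
  -- with 𝔪.
  obtain ⟨e, he⟩ := hI.exists_eq_smul (f ∘ₗ g)
  obtain ⟨s, hs, hns⟩ := exists_smul_notMem_and_maximalIdeal_smul_mem (Ideal.span {x})
    (z := (1 : A)) (fun h => (Ideal.ne_top_iff_one _).mp (by
      rw [Ne, Ideal.span_singleton_eq_top]; exact hxm) h) hx
    (by simp)
  simp only [smul_eq_mul, mul_one] at hs hns
  have hpe : ∀ a ∈ maximalIdeal A, a • p e = 0 := fun a ha => by
    rw [← map_smul, ← he ⟨a, ha⟩]
    exact hfp.apply_apply_eq_zero _
  -- The map x ↦ 0, s ↦ p e on (x) + (s), extended by injectivity of Y, yields y with xy = 0 and sy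
  -- = p e.
  obtain ⟨g', hg', hg's⟩ := LinearMap.exists_extend_sup_span_singleton
    (0 : Ideal.span {x} →ₗ[A] Y) s (p e) fun c hc => by
      rw [LinearMap.zero_apply, hpe]
      rw [mem_maximalIdeal, mem_nonunits_iff]
      exact fun hu => hs ((Ideal.unit_mul_mem_iff_mem _ hu).mp hc)
  obtain ⟨y, hy⟩ := hY.exists_eq_smul g'
  have hxy : x • y = 0 := by
    have hx' := Ideal.mem_span_singleton_self x
    rw [← hy ⟨x, Submodule.mem_sup_left hx'⟩, hg' x hx', LinearMap.zero_apply]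
  have hsy : s • y = p e := by
    have hs' := Submodule.mem_sup_right (S := Ideal.span {x}) (Submodule.mem_span_singleton_self s)
    rw [← hg's hs']
    exact (hy ⟨s, hs'⟩).symm
  obtain ⟨y₁, rfl⟩ := hp y
  rw [← map_smul] at hxy hsy
  obtain ⟨v, hv⟩ := (hfp _).mp hxy
  -- Divisibility of X corrects the lift y₁ of y so that x kills it. As 𝔪s ⊆ (x), subtracting s
  -- times this lift from e leaves the products with 𝔪 unchanged.
  obtain ⟨w, rfl⟩ := hX x hx v
  have hx0 : x • (y₁ - f w) = 0 := by rw [smul_sub, ← map_smul, hv, sub_self]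
  obtain ⟨e', he'⟩ := (hfp (e - s • (y₁ - f w))).mp (by
    rw [smul_sub, map_sub, map_sub, hsy, ← map_smul f, hfp.apply_apply_eq_zero, sub_zero, sub_self])
  refine ⟨e', fun a => hf ?_⟩
  rw [map_smul, he', smul_sub, ← he a, smul_smul]
  obtain ⟨d, hd⟩ := Ideal.mem_span_singleton'.mp (hns a a.2)
  rw [← hd, mul_smul, hx0, smul_zero, sub_zero]
  rfl

end DivisibleModules

/-! ### Finite injective dimension and injectivity of K/A -/

section InjectiveDimension

universe u

open CategoryTheory

variable {A : Type u} [CommRing A] [IsDomain A] [IsLocalRing A] [IsNoetherianRing A]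
  [Ring.KrullDimLE 1 A]

/-- A divisible module of finite injective dimension over a one-dimensional Noetherian local domain
is injective. -/
theorem Module.Baer.of_hasInjectiveDimensionLE_of_divisible (n : ℕ) (X : ModuleCat.{u} A)
    (hX : ∀ a : A, a ≠ 0 → ∀ v : X, ∃ w, a • w = v) (h : HasInjectiveDimensionLE X n) :
    Module.Baer A X := by
  induction n generalizing X with
  | zero =>
    rw [Module.Baer.iff_injective, Module.injective_iff_injective_object]
    exact injective_iff_hasInjectiveDimensionLT_one.mpr h
  | succ n ih =>
    let ⟨I, _, f, _⟩ := EnoughInjectives.presentation X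
    have hI : Module.Injective A I := Module.injective_module_of_injective_object A I
    have injf : Function.Injective f.hom := (ModuleCat.mono_iff_injective f).mp ‹_›
    let S : ShortComplex (ModuleCat.{u} A) :=
      ModuleCat.shortComplexOfCompEqZero _ _ f.hom.exact_map_mkQ_range.linearMap_comp_eq_zero
    have exactS := ModuleCat.shortComplex_shortExact S
      f.hom.exact_map_mkQ_range injf (Submodule.mkQ_surjective _)
    have hIdiv : ∀ a : A, a ≠ 0 → ∀ v : I, ∃ w, a • w = v := by
      intro a ha v
      let m : A →ₗ[A] A := LinearMap.mulLeft A a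
      obtain ⟨l, hl⟩ := hI.out m (mul_right_injective₀ ha) (LinearMap.toSpanSingleton A I v)
      refine ⟨l 1, ?_⟩
      have := hl 1
      rw [← map_smul]
      simpa [m] using this
    have hY := ih S.X₃ (by
      intro a ha v
      obtain ⟨v, rfl⟩ := Submodule.mkQ_surjective _ v
      obtain ⟨w, rfl⟩ := hIdiv a ha v
      exact ⟨Submodule.mkQ _ w, (map_smul _ _ _).symm⟩)
      ((exactS.hasInjectiveDimensionLT_X₃_iff n inferInstance).mpr h)
    exact Module.Baer.of_injective_of_surjective f.hom (Submodule.mkQ _) injf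
      (Submodule.mkQ_surjective _) f.hom.exact_map_mkQ_range
      (Module.Baer.of_injective hI) hY hX

section

variable {B : Type u} [CommRing B] (K : Type u) [Field K] [Algebra B K]
  [FaithfulSMul B K]

theorem Module.Baer.of_field : Module.Baer B K := by
  intro I g
  by_cases hI : I = ⊥
  · subst hI
    refine ⟨0, fun x hx => ?_⟩
    have : (⟨x, hx⟩ : (⊥ : Ideal B)) = 0 := Subtype.ext ((Submodule.mem_bot B).mp hx)
    rw [this, map_zero, LinearMap.zero_apply]
  obtain ⟨r, hrI, hr⟩ := Submodule.exists_mem_ne_zero_of_ne_bot hI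
  have hr' : algebraMap B K r ≠ 0 := by simpa using hr
  refine ⟨LinearMap.toSpanSingleton B K (g ⟨r, hrI⟩ / algebraMap B K r), fun x hx => ?_⟩
  rw [LinearMap.toSpanSingleton_apply, Algebra.smul_def, mul_div_assoc', div_eq_iff hr',
    ← Algebra.smul_def, mul_comm, ← Algebra.smul_def, ← map_smul, ← map_smul]
  congr 1
  ext
  simp [mul_comm]

variable (B) in
/-- The short exact sequence `0 → B → K → K ⧸ B → 0`. -/
theorem shortExact_algebra_linearMap_mkQ : (ModuleCat.shortComplexOfCompEqZero _ _
      (Algebra.linearMap B K).exact_map_mkQ_range.linearMap_comp_eq_zero).ShortExact :=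
  ModuleCat.shortComplex_shortExact _ (Algebra.linearMap B K).exact_map_mkQ_range
    (FaithfulSMul.algebraMap_injective B K) (Submodule.mkQ_surjective _)

end

variable (K : Type u) [Field K] [Algebra A K] [FaithfulSMul A K]

/-- A one-dimensional Noetherian local domain `A` contained in a field `K` has finite injective
dimension over itself if and only if `K ⧸ A` is injective. -/
theorem exists_hasInjectiveDimensionLE_iff_baer :
    (∃ n : ℕ, HasInjectiveDimensionLE (ModuleCat.of A A) n) ↔
      Module.Baer A (K ⧸ LinearMap.range (Algebra.linearMap A K)) := by
  have hK : Injective (ModuleCat.of A K) := by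
    rw [← Module.injective_iff_injective_object, ← Module.Baer.iff_injective]
    exact Module.Baer.of_field K
  have hS := shortExact_algebra_linearMap_mkQ A K
  constructor
  · rintro ⟨n, hn⟩
    -- The bound n for A is weakened to n + 1, so that K/A gets the bound n and n = 0 needs no
    -- separate case.
    refine Module.Baer.of_hasInjectiveDimensionLE_of_divisible n
      (ModuleCat.of A (K ⧸ LinearMap.range (Algebra.linearMap A K))) ?_
      ((hS.hasInjectiveDimensionLT_X₃_iff n hK).mpr
        (hasInjectiveDimensionLT_of_ge (ModuleCat.of A A) (n + 1) (n + 2) (by lia)))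
    intro a ha v
    obtain ⟨v, rfl⟩ := Submodule.mkQ_surjective _ v
    refine ⟨Submodule.mkQ _ ((algebraMap A K a)⁻¹ * v), ?_⟩
    rw [← map_smul, Algebra.smul_def, mul_inv_cancel_left₀ (by simpa using ha)]
  · intro h
    refine ⟨1, (hS.hasInjectiveDimensionLT_X₃_iff 0 hK).mp ?_⟩
    rw [zero_add, ← injective_iff_hasInjectiveDimensionLT_one]
    exact Module.injective_object_of_injective_module (inj := h.injective)

end InjectiveDimension

/-! ### The socle of A/(x) when K/A is injective -/

section Socle

variable {A : Type*} [CommRing A] [IsLocalRing A] (K : Type*) [Field K] [Algebra A K]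
  [FaithfulSMul A K]

/-- If `K ⧸ A` is injective, then the socle of `A ⧸ (x)` is generated by any of its nonzero
elements. -/
theorem mem_sup_span_of_baer (hE : Module.Baer A (K ⧸ LinearMap.range (Algebra.linearMap A K)))
    {x s s' : A} (hx : x ≠ 0) (hs : s ∉ Ideal.span {x})
    (hns : ∀ a ∈ maximalIdeal A, a * s ∈ Ideal.span {x})
    (hns' : ∀ a ∈ maximalIdeal A, a * s' ∈ Ideal.span {x}) :
    s' ∈ Ideal.span {x} ⊔ Ideal.span {s} := by
  by_contra hs'
  have hx' : algebraMap A K x ≠ 0 := by simpa using hx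
  have hmax : ∀ {J : Ideal A} {c t : A}, t ∉ J → c * t ∈ J → c ∈ maximalIdeal A := by
    intro J c t ht hct
    rw [mem_maximalIdeal, mem_nonunits_iff]
    exact fun hu => ht ((Ideal.unit_mul_mem_iff_mem _ hu).mp hct)
  let q := Submodule.mkQ (LinearMap.range (Algebra.linearMap A K))
  have hq : ∀ b : K, q b = 0 ↔ ∃ a, algebraMap A K a = b := fun b =>
    Submodule.Quotient.mk_eq_zero _
  have hdiv : ∀ c : A, (∃ a, algebraMap A K a = algebraMap A K c / algebraMap A K x) ↔
      c ∈ Ideal.span {x} := by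
    intro c
    rw [Ideal.mem_span_singleton']
    refine exists_congr fun a => ?_
    rw [eq_div_iff hx', ← map_mul, (FaithfulSMul.algebraMap_injective A K).eq_iff]
  -- The test map kills x and s and sends s' to s/x, a nonzero socle element of K/A. Its multiplier
  -- is y = b/x with sb ∈ (x), so b is a nonunit and s'y ∈ A, a contradiction.
  obtain ⟨g', hg', hg's⟩ := LinearMap.exists_extend_sup_span_singleton
    (0 : ↥(Ideal.span {x} ⊔ Ideal.span {s}) →ₗ[A] _) s'
    (q (algebraMap A K s / algebraMap A K x)) fun c hc => by
      rw [LinearMap.zero_apply, ← map_smul, eq_comm, hq, Algebra.smul_def, ← mul_div_assoc,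
        ← map_mul, hdiv]
      exact hns c (hmax hs' hc)
  obtain ⟨y, hy⟩ := hE.exists_eq_smul g'
  obtain ⟨y, rfl⟩ := Submodule.mkQ_surjective _ y
  have key : ∀ t ∈ Ideal.span {x} ⊔ Ideal.span {s},
      ∃ a, algebraMap A K a = algebraMap A K t * y := by
    intro t ht
    rw [← Algebra.smul_def, ← hq, map_smul]
    exact (hy ⟨t, Submodule.mem_sup_left ht⟩).symm.trans (hg' t ht _)
  obtain ⟨b, hb⟩ := key x (Submodule.mem_sup_left (Ideal.mem_span_singleton_self x))
  obtain ⟨d, hd⟩ := key s (Submodule.mem_sup_right (Ideal.mem_span_singleton_self s))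
  have hy' : y = algebraMap A K b / algebraMap A K x := by rw [hb]; field_simp
  have hbm : b ∈ maximalIdeal A := by
    refine hmax hs ((hdiv _).mp ⟨d, ?_⟩)
    rw [hd, hy', map_mul]; ring
  have hsp := Submodule.mem_sup_right (S := Ideal.span {x} ⊔ Ideal.span {s})
    (Submodule.mem_span_singleton_self s')
  have h1 : s' • q y = q (algebraMap A K s / algebraMap A K x) :=
    (hy ⟨s', hsp⟩).symm.trans (hg's hsp)
  have h2 : s' • q y = 0 := by
    rw [← map_smul, hq, Algebra.smul_def, hy', mul_div_assoc', ← map_mul, hdiv, mul_comm]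
    exact hns' b hbm
  rw [h2, eq_comm, hq, hdiv] at h1
  exact hs h1

end Socle

/-! ### Reflexivity with respect to ω -/

section Canonical

variable {R : Type*} [CommRing R] [IsDomain R] {K : Type*} [Field K] [Algebra R K]

/-- Reflexivity as a separation principle: a z outside J is detected by some y with yJ ⊆ ω and yz ∉
ω. -/
theorem IsCanonicalIdeal.mem_of_forall [IsFractionRing R K] {ω : FractionalIdeal R⁰ K}
    (hω : IsCanonicalIdeal ω)
    {J : Submodule R K} (hJ : IsFractional R⁰ J) (hJ0 : ∃ j ∈ J, j ≠ 0) {z : K}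
    (h : ∀ y : K, (∀ j ∈ J, y * j ∈ ω) → y * z ∈ ω) : z ∈ J := by
  let J' : FractionalIdeal R⁰ K := ⟨J, hJ⟩
  have hJ' : J' ≠ 0 := by
    obtain ⟨j, hj, hj0⟩ := hJ0
    intro h0
    have : j ∈ J' := hj
    rw [h0, FractionalIdeal.mem_zero_iff] at this
    exact hj0 this
  have key := hω.2 J' hJ'
  have hD : ω / J' ≠ 0 := by
    intro h0
    rw [h0, FractionalIdeal.div_zero] at key
    exact hJ' key.symm
  change z ∈ J'
  rw [← key, FractionalIdeal.mem_div_iff_of_ne_zero hD]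
  intro y hy
  rw [mul_comm]
  exact h y ((FractionalIdeal.mem_div_iff_of_ne_zero hJ').mp hy)

variable [IsLocalRing R] [IsNoetherianRing R] [Ring.KrullDimLE 1 R]

/-- If `(ω : 𝔪) ⧸ ω` is simple, then reflexivity with respect to `ω` passes from a submodule of
finite colength to the whole module. -/
theorem Submodule.div_div_le_of_simple (ω : Submodule R K)
    (hω : ∀ u v : K, (∀ a ∈ maximalIdeal R, a • u ∈ ω) → (∀ a ∈ maximalIdeal R, a • v ∈ ω) →
      v ∉ ω → ∃ r : R, u - r • v ∈ ω)
    {I J : Submodule R K} [IsNoetherian R J] (hIJ : I ≤ J) (hI : ω / (ω / I) ≤ I) {r : R}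
    (hr : r ≠ 0) (hrJ : ∀ j ∈ J, r • j ∈ I) : ω / (ω / J) ≤ J := by
  simp only [SetLike.le_def, Submodule.mem_div_iff_forall_mul_mem] at hI ⊢
  -- W is a largest reflexive submodule between I and J. If W ≠ J, adjoining an element t that
  -- represents a socle element of J/W is shown to preserve reflexivity.
  obtain ⟨W, ⟨hIW, hW⟩, hmax⟩ := WellFounded.has_min (wellFounded_gt (α := Submodule R J))
    {W | I ≤ W.map J.subtype ∧ ω / (ω / W.map J.subtype) ≤ W.map J.subtype}
    ⟨I.comap J.subtype, by
      have : (I.comap J.subtype).map J.subtype = I := by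
        rw [Submodule.map_comap_eq, Submodule.range_subtype, inf_eq_right.mpr hIJ]
      rw [Set.mem_ofPred_eq, this]
      exact ⟨le_rfl, fun z hz => hI (by
        simpa only [Submodule.mem_div_iff_forall_mul_mem] using hz)⟩⟩
  simp only [SetLike.le_def, Submodule.mem_div_iff_forall_mul_mem] at hW
  by_cases hWtop : W = ⊤
  · subst hWtop
    simpa using hW
  exfalso
  obtain ⟨z, hz⟩ : ∃ z, z ∉ W := by
    by_contra! h
    exact hWtop (eq_top_iff.mpr fun z _ => h z)
  obtain ⟨c, hc, hmc⟩ := exists_smul_notMem_and_maximalIdeal_smul_mem W hz hr (by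
    obtain ⟨w, hw, hw'⟩ := hIW (hrJ z z.2)
    have : w = r • z := Subtype.ext hw'
    exact this ▸ hw)
  set t := c • z with ht
  have hWN : ∀ w : J, (w : K) ∈ W.map J.subtype ↔ w ∈ W := fun w => by simp
  refine hmax (W ⊔ Submodule.span R {t}) ⟨?_, ?_⟩ (lt_of_le_of_ne le_sup_left fun h => hc (by
    rw [h]; exact Submodule.mem_sup_right (Submodule.mem_span_singleton_self t)))
  · exact hIW.trans (Submodule.map_mono le_sup_left)
  have htω : ∃ y₀ : K, (∀ w ∈ W.map J.subtype, y₀ * w ∈ ω) ∧ y₀ * (t : K) ∉ ω := by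
    by_contra! h
    exact hc ((hWN t).mp (hW fun y hy => by rw [mul_comm]; exact h y hy))
  obtain ⟨y₀, hy₀, hy₀t⟩ := htω
  have hmt : ∀ a ∈ maximalIdeal R, ∀ y : K, (∀ w ∈ W.map J.subtype, y * w ∈ ω) →
      a • (y * (t : K)) ∈ ω := by
    intro a ha y hy
    rw [← mul_smul_comm]
    exact hy _ ((hWN (a • t)).mpr (hmc a ha))
  have hJ₁ : ∀ y : K, (∀ w ∈ W.map J.subtype, y * w ∈ ω) → y * (t : K) ∈ ω →
      ∀ w ∈ (W ⊔ Submodule.span R {t}).map J.subtype, y * w ∈ ω := by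
    rintro y hy hyt _ ⟨w, hw, rfl⟩
    obtain ⟨w₁, hw₁, w₂, hw₂, rfl⟩ := Submodule.mem_sup.mp hw
    obtain ⟨d, rfl⟩ := Submodule.mem_span_singleton.mp hw₂
    rw [map_add, mul_add, map_smul, mul_smul_comm]
    exact add_mem (hy _ ⟨w₁, hw₁, rfl⟩) (ω.smul_mem d hyt)
  intro q hq
  rw [Submodule.mem_div_iff_forall_mul_mem] at hq
  simp only [Submodule.mem_div_iff_forall_mul_mem] at hq
  -- Both products lie in ω : 𝔪, so simplicity gives r' with y₀(q − r't) ∈ ω.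
  obtain ⟨r', hr'⟩ := hω (y₀ * q) (y₀ * t) (fun a ha => by
      rw [← smul_mul_assoc, mul_comm]
      refine hq _ (hJ₁ _ (fun w hw => ?_) ?_)
      · rw [smul_mul_assoc]; exact ω.smul_mem a (hy₀ w hw)
      · rw [smul_mul_assoc]; exact hmt a ha y₀ hy₀)
    (fun a ha => hmt a ha y₀ hy₀) hy₀t
  have hmem : q - r' • (t : K) ∈ W.map J.subtype := by
    refine hW fun y hy => ?_
    -- Each y in ω : W differs from a multiple of y₀ by an element of ω : (W + Rt), which q
    -- multiplies into ω. Hence q − r't ∈ ω : (ω : W) ⊆ W.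
    obtain ⟨p, hp⟩ := hω (y * t) (y₀ * t) (fun a ha => hmt a ha y hy)
      (fun a ha => hmt a ha y₀ hy₀) hy₀t
    have hd : (y - p • y₀) * (t : K) ∈ ω := by rwa [sub_mul, smul_mul_assoc]
    have hd' := hq (y - p • y₀) (hJ₁ _ (fun w hw => by
      rw [sub_mul, smul_mul_assoc]
      exact sub_mem (hy w hw) (ω.smul_mem p (hy₀ w hw))) hd)
    have : (q - r' • (t : K)) * y =
        p • (y₀ * q - r' • (y₀ * t)) + q * (y - p • y₀) - r' • ((y - p • y₀) * t) := by
      simp only [Algebra.smul_def]; ring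
    rw [this]
    exact sub_mem (add_mem (ω.smul_mem p hr') hd') (ω.smul_mem r' hd)
  have : q = (q - r' • (t : K)) + r' • (t : K) := by ring
  rw [this]
  refine add_mem (Submodule.map_mono le_sup_left hmem) (Submodule.smul_mem _ _ ?_)
  exact ⟨t, Submodule.mem_sup_right (Submodule.mem_span_singleton_self t), rfl⟩

end Canonical

/-! ### Stability gives 𝔪 = xΛ -/

section BlowUp

variable {R : Type*} [CommRing R] [IsLocalRing R]
  {K : Type*} [Field K] [Algebra R K] [IsFractionRing R K]

/-- If the integral closure is a discrete valuation ring, then `𝔪` contains an element which divides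
every element of `𝔪` in the integral closure. -/
theorem exists_mem_maximalIdeal_div_mem_integralClosure
    [IsDiscreteValuationRing (integralClosure R K)] (hR : ¬IsField R) : ∃ x ∈ maximalIdeal R, x ≠ 0 ∧
      ∀ u ∈ maximalIdeal R, algebraMap R K u / algebraMap R K x ∈ integralClosure R K := by
  obtain ⟨x₀, hx₀, hx₀0⟩ := Submodule.exists_mem_ne_zero_of_ne_bot
    (isField_iff_maximalIdeal_eq.not.mp hR)
  let v : R → ℕ∞ := fun a =>
    IsDiscreteValuationRing.addVal (integralClosure R K) (algebraMap R (integralClosure R K) a)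
  obtain ⟨x, ⟨hx, hx0⟩, hmin⟩ := WellFounded.has_min (InvImage.wf v wellFounded_lt)
    {a | a ∈ maximalIdeal R ∧ a ≠ 0} ⟨x₀, hx₀, hx₀0⟩
  refine ⟨x, hx, hx0, fun u hu => ?_⟩
  have hxK : algebraMap R K x ≠ 0 := by simpa using hx0
  by_cases hu0 : u = 0
  · simp [hu0]
  have hle : v x ≤ v u := not_lt.mp (hmin u ⟨hu, hu0⟩)
  obtain ⟨y, hy⟩ := IsDiscreteValuationRing.addVal_le_iff_dvd.mp hle
  have hy' : algebraMap R K u = algebraMap R K x * y := congrArg Subtype.val hy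
  rw [hy', mul_div_cancel_left₀ _ hxK]
  exact y.2

variable [IsNoetherianRing R]

/-- If the quotients `u / x` with `u ∈ 𝔪` are integral, then `u / x` lies in the blowing-up of
`𝔪`. -/
theorem div_mem_blowUp [Module.Finite R (integralClosure R K)] {x : R} (hx : x ∈ maximalIdeal R)
    (hx0 : x ≠ 0)
    (h : ∀ u ∈ maximalIdeal R, algebraMap R K u / algebraMap R K x ∈ integralClosure R K)
    {u : R} (hu : u ∈ maximalIdeal R) :
    algebraMap R K u / algebraMap R K x ∈ blowUp R K (maximalIdeal R) := by
  have hxK : algebraMap R K x ≠ 0 := by simpa using hx0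
  set 𝔪 := IsLocalization.coeSubmodule K (maximalIdeal R) with h𝔪
  have hmem : ∀ {a}, a ∈ maximalIdeal R → algebraMap R K a ∈ 𝔪 := fun ha => ⟨_, ha, rfl⟩
  have hint : ∀ (n : ℕ) (w : K), w ∈ 𝔪 ^ n → w / algebraMap R K x ^ n ∈ integralClosure R K := by
    intro n
    induction n with
    | zero =>
      intro w hw
      rw [pow_zero, Submodule.mem_one] at hw
      obtain ⟨a, rfl⟩ := hw
      rw [pow_zero, div_one]
      exact algebraMap_mem _ a
    | succ n ih =>
      intro w hw
      rw [pow_succ] at hw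
      induction hw using Submodule.mul_induction_on' with
      | mem_mul_mem a ha b hb =>
        obtain ⟨b, hb, rfl⟩ := hb
        rw [pow_succ, mul_div_mul_comm]
        exact mul_mem (ih a ha) (h b hb)
      | add a _ b _ ha hb => rw [add_div]; exact add_mem ha hb
  -- The chain x⁻ⁿ𝔪ⁿ in R̄ increases and stabilizes; at a stable n, multiplication by u/x preserves
  -- 𝔪ⁿ.
  let N : ℕ →o Submodule R (integralClosure R K) :=
    { toFun := fun n => (𝔪 ^ n).comap
        (LinearMap.mulLeft R (algebraMap R K x ^ n) ∘ₗ (integralClosure R K).val.toLinearMap)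
      monotone' := monotone_nat_of_le_succ fun n y hy => by
        change algebraMap R K x ^ (n + 1) * (y : K) ∈ 𝔪 ^ (n + 1)
        rw [pow_succ', pow_succ', mul_assoc]
        exact Submodule.mul_mem_mul (hmem hx) hy }
  obtain ⟨n, hn⟩ := monotone_stabilizes_iff_noetherian.mpr
    (inferInstanceAs (IsNoetherian R (integralClosure R K))) N
  refine ⟨n, ?_⟩
  rw [Submodule.mem_div_iff_forall_mul_mem]
  intro w hw
  have huw : algebraMap R K u * w ∈ 𝔪 ^ (n + 1) := by
    rw [pow_succ']; exact Submodule.mul_mem_mul (hmem hu) hw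
  let y : integralClosure R K := ⟨_, hint _ _ huw⟩
  have hy : y ∈ N (n + 1) := by
    change algebraMap R K x ^ (n + 1) * (algebraMap R K u * w / algebraMap R K x ^ (n + 1)) ∈
      𝔪 ^ (n + 1)
    rwa [mul_div_cancel₀ _ (pow_ne_zero _ hxK)]
  rw [← hn (n + 1) (Nat.le_succ n)] at hy
  have hy' : algebraMap R K x ^ n * (algebraMap R K u * w / algebraMap R K x ^ (n + 1)) ∈ 𝔪 ^ n :=
    hy
  convert hy' using 1
  field_simp
  ring

/-- If `𝔪` is stable, then `𝔪 = x Λ` for some `x ∈ 𝔪`. -/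
theorem IsStableMaximalIdeal.exists_mem_blowUp_iff [Module.Finite R (integralClosure R K)]
    [IsDiscreteValuationRing (integralClosure R K)] (hR : ¬IsField R)
    (hstable : IsStableMaximalIdeal R K) : ∃ x ∈ maximalIdeal R, x ≠ 0 ∧
      ∀ y : K, y ∈ blowUp R K (maximalIdeal R) ↔
        ∃ u ∈ maximalIdeal R, algebraMap R K u = algebraMap R K x * y := by
  obtain ⟨x, hx, hx0, h⟩ := exists_mem_maximalIdeal_div_mem_integralClosure (K := K) hR
  have hxK : algebraMap R K x ≠ 0 := by simpa using hx0
  refine ⟨x, hx, hx0, fun y => ⟨fun hy => ?_, ?_⟩⟩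
  · rw [← Subalgebra.mem_toSubmodule, hstable, Submodule.mem_div_iff_forall_mul_mem] at hy
    obtain ⟨u, hu, hu'⟩ := hy _ ⟨x, hx, rfl⟩
    exact ⟨u, hu, hu'.trans (mul_comm _ _)⟩
  · rintro ⟨u, hu, hu'⟩
    have : y = algebraMap R K u / algebraMap R K x := by rw [hu']; field_simp
    rw [this]
    exact div_mem_blowUp hx hx0 h hu

end BlowUp

/-! ### Membership in fractional ideals and in K/S -/

section Membership

variable {R : Type*} [CommRing R] {K : Type*} [Field K] [Algebra R K]

theorem FractionalIdeal.algebraMap_mem_of_one_le {ω : FractionalIdeal R⁰ K} (hω1 : 1 ≤ ω) (r : R) :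
    algebraMap R K r ∈ ω :=
  hω1 ((FractionalIdeal.mem_one_iff R⁰).mpr ⟨r, rfl⟩)

theorem FractionalIdeal.algebraMap_mul_mem {ω : FractionalIdeal R⁰ K} (r : R) {y : K}
    (hy : y ∈ ω) : algebraMap R K r * y ∈ ω := by
  rw [← Algebra.smul_def]
  exact Submodule.smul_mem (ω : Submodule R K) r hy

theorem Subalgebra.mkQ_range_eq_zero_iff {S : Subalgebra R K} (b : K) :
    Submodule.mkQ (LinearMap.range (Algebra.linearMap S K)) b = 0 ↔ b ∈ S :=
  (Submodule.Quotient.mk_eq_zero _).trans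
    ⟨fun ⟨a, ha⟩ => ha ▸ a.2, fun hb => ⟨⟨b, hb⟩, rfl⟩⟩

theorem FractionalIdeal.mem_maximalIdeal_of_algebraMap_mul_mem [IsLocalRing R]
    {ω : FractionalIdeal R⁰ K} {r : R} {y : K}
    (hy : y ∉ ω) (hry : algebraMap R K r * y ∈ ω) : r ∈ maximalIdeal R := by
  rw [mem_maximalIdeal, mem_nonunits_iff]
  intro hu
  obtain ⟨t, ht⟩ := hu.exists_left_inv
  refine hy ?_
  have := FractionalIdeal.algebraMap_mul_mem t hry
  rwa [← mul_assoc, ← map_mul, ht, map_one, one_mul] at this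

end Membership

/-! ### Overrings S with 𝔪 = xS -/

section PrincipalOverring

variable {R : Type*} [CommRing R] [IsLocalRing R] {K : Type*} [Field K] [Algebra R K]

/-- The overring `S` of the local ring `R` satisfies `𝔪 = x S`. -/
structure MaximalIdealEqMul (S : Subalgebra R K) (x : R) : Prop where
  mem : x ∈ maximalIdeal R
  ne_zero : x ≠ 0
  mem_iff : ∀ y : K, y ∈ S ↔ ∃ u ∈ maximalIdeal R, algebraMap R K u = algebraMap R K x * y

namespace MaximalIdealEqMul

variable {S : Subalgebra R K} {x : R}

theorem isFractional [IsDomain R] (h : MaximalIdealEqMul S x) {J : Submodule R K}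
    (hJ : ∀ j ∈ J, j ∈ S) : IsFractional R⁰ J := by
  refine ⟨x, mem_nonZeroDivisors_of_ne_zero h.ne_zero, fun j hj => ?_⟩
  obtain ⟨u, -, hu⟩ := (h.mem_iff j).mp (hJ j hj)
  exact ⟨u, hu.trans (Algebra.smul_def _ _).symm⟩

variable [IsFractionRing R K]

theorem algebraMap_ne_zero (h : MaximalIdealEqMul S x) : algebraMap R K x ≠ 0 := by
  simpa using h.ne_zero

/-- Multiplication by `x` identifies `S` with the maximal ideal of `R`. -/
theorem exists_linearEquiv (h : MaximalIdealEqMul S x) : Nonempty (maximalIdeal R ≃ₗ[R] S) := by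
  have hxK := h.algebraMap_ne_zero
  let f : maximalIdeal R →ₗ[R] S :=
    { toFun := fun u => ⟨algebraMap R K u / algebraMap R K x,
        (h.mem_iff _).mpr ⟨u, u.2, by field_simp⟩⟩
      map_add' := fun a b => Subtype.ext (by simp [add_div])
      map_smul' := fun r a => Subtype.ext (by simp [Algebra.smul_def, mul_div_assoc]) }
  refine ⟨LinearEquiv.ofBijective f ⟨?_, ?_⟩⟩
  · intro a b hab
    have hab' : algebraMap R K a / algebraMap R K x = algebraMap R K b / algebraMap R K x :=
      congrArg Subtype.val hab
    rw [div_left_inj' hxK] at hab'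
    exact Subtype.ext (IsFractionRing.injective R K hab')
  · rintro ⟨y, hy⟩
    obtain ⟨u, hu, hu'⟩ := (h.mem_iff y).mp hy
    refine ⟨⟨u, hu⟩, Subtype.ext ?_⟩
    change algebraMap R K u / algebraMap R K x = y
    rw [hu']; field_simp

theorem finite (h : MaximalIdealEqMul S x) [IsNoetherianRing R] : Module.Finite R S := by
  obtain ⟨e⟩ := h.exists_linearEquiv
  exact Module.Finite.equiv e

theorem isNoetherianRing (h : MaximalIdealEqMul S x) [IsNoetherianRing R] : IsNoetherianRing S :=
  have := h.finite
  IsNoetherianRing.of_finite R S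

theorem le_integralClosure (h : MaximalIdealEqMul S x) [IsNoetherianRing R] :
    S ≤ integralClosure R K := by
  have := h.finite
  intro y hy
  have : IsIntegral R (⟨y, hy⟩ : S) := Algebra.IsIntegral.isIntegral _
  exact this.map S.val

theorem krullDimLE_one [IsDomain R] (h : MaximalIdealEqMul S x) [IsNoetherianRing R]
    [Ring.KrullDimLE 1 R] : Ring.KrullDimLE 1 S := by
  have := h.finite
  rw [Ring.krullDimLE_one_iff_of_noZeroDivisors]
  intro P hP hPp
  have hne : P.comap (algebraMap R S) ≠ ⊥ := Ideal.IsIntegral.comap_ne_bot R hP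
  exact Ideal.isMaximal_of_isIntegral_of_isMaximal_comap P
    (Ideal.IsPrime.isMaximal_of_ne_bot inferInstance hne)

/-- R̄ is integral over R, hence over S, and injective integral extensions reflect units; S
therefore inherits locality from R̄. -/
theorem isLocalHom_inclusion (h : MaximalIdealEqMul S x) [IsNoetherianRing R] :
    IsLocalHom (Subalgebra.inclusion h.le_integralClosure).toRingHom := by
  refine RingHom.IsIntegral.isLocalHom (fun y => ?_) (Subalgebra.inclusion_injective _)
  have hy : IsIntegral R y := Algebra.IsIntegral.isIntegral y
  obtain ⟨p, hp, hpy⟩ := hy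
  refine ⟨p.map (algebraMap R S), hp.map _, ?_⟩
  rw [Polynomial.eval₂_map]
  exact hpy

theorem isLocalRing (h : MaximalIdealEqMul S x) [IsNoetherianRing R]
    [IsLocalRing (integralClosure R K)] : IsLocalRing S :=
  have := h.isLocalHom_inclusion
  (Subalgebra.inclusion h.le_integralClosure).toRingHom.domain_isLocalRing

/-- If the integral closure is residually rational, then so is `S`. -/
theorem exists_sub_algebraMap_mem (h : MaximalIdealEqMul S x) [IsNoetherianRing R]
    [IsLocalRing (integralClosure R K)]
    [IsLocalRing S]
    (hres : Function.Surjective (algebraMap R (ResidueField (integralClosure R K)))) (a : S) :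
    ∃ r : R, a - algebraMap R S r ∈ maximalIdeal S := by
  let ι := Subalgebra.inclusion h.le_integralClosure
  obtain ⟨r, hr⟩ := hres (residue _ (ι a))
  refine ⟨r, ?_⟩
  rw [mem_maximalIdeal, mem_nonunits_iff]
  intro hu
  have hu' := hu.map ι
  have hzero : residue _ (ι (a - algebraMap R S r)) = 0 := by
    rw [map_sub, map_sub, sub_eq_zero, ← hr]
    rfl
  rw [residue_eq_zero_iff, mem_maximalIdeal, mem_nonunits_iff] at hzero
  exact hzero hu'

theorem mem_span_iff (h : MaximalIdealEqMul S x) (a : S) : a ∈ Ideal.span {algebraMap R S x} ↔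
    ∃ u ∈ maximalIdeal R, algebraMap R K u = a := by
  rw [Ideal.mem_span_singleton']
  constructor
  · rintro ⟨b, rfl⟩
    obtain ⟨u, hu, hu'⟩ := (h.mem_iff b).mp b.2
    exact ⟨u, hu, hu'.trans (mul_comm _ _)⟩
  · rintro ⟨u, hu, hu'⟩
    have hxK := h.algebraMap_ne_zero
    refine ⟨⟨(a : K) / algebraMap R K x, (h.mem_iff _).mpr ⟨u, hu, ?_⟩⟩, Subtype.ext ?_⟩
    · rw [hu']; field_simp
    · change (a : K) / algebraMap R K x * algebraMap R K x = a
      field_simp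

/-- This is 𝔪S ⊆ 𝔪: u/x lies in S, so ua = x · (u/x)a lies in xS. -/
theorem exists_mul_eq (h : MaximalIdealEqMul S x) {u : R} (hu : u ∈ maximalIdeal R) {a : K}
    (ha : a ∈ S) :
    ∃ v ∈ maximalIdeal R, algebraMap R K v = algebraMap R K u * a := by
  have hxK := h.algebraMap_ne_zero
  have hux : algebraMap R K u / algebraMap R K x ∈ S :=
    (h.mem_iff _).mpr ⟨u, hu, by field_simp⟩
  obtain ⟨v, hv, hv'⟩ := (h.mem_iff _).mp (mul_mem hux ha)
  exact ⟨v, hv, by rw [hv']; field_simp⟩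

theorem algebraMap_notMem_span_of_isUnit (h : MaximalIdealEqMul S x) {r : R} (hr : IsUnit r) :
    algebraMap R S r ∉ Ideal.span {algebraMap R S x} := by
  rw [h.mem_span_iff]
  rintro ⟨u, hu, hu'⟩
  have : u = r := IsFractionRing.injective R K hu'
  exact hu (this ▸ hr)

theorem algebraMap_mem_maximalIdeal (h : MaximalIdealEqMul S x) [IsLocalRing S] :
    algebraMap R S x ∈ maximalIdeal S := by
  rw [mem_maximalIdeal, mem_nonunits_iff, ← Ideal.span_singleton_eq_top]
  refine (Ideal.ne_top_iff_one _).mpr ?_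
  simpa using h.algebraMap_notMem_span_of_isUnit isUnit_one

theorem mul_mem_of_one_le (h : MaximalIdealEqMul S x) {ω : FractionalIdeal R⁰ K} (hω1 : 1 ≤ ω)
    {u : R}
    (hu : u ∈ maximalIdeal R) {a : K} (ha : a ∈ S) : algebraMap R K u * a ∈ ω := by
  obtain ⟨v, -, hv⟩ := h.exists_mul_eq hu ha
  exact hv ▸ FractionalIdeal.algebraMap_mem_of_one_le hω1 v

theorem mkQ_range_div_eq_zero_iff (h : MaximalIdealEqMul S x) (c : K) :
    Submodule.mkQ (LinearMap.range (Algebra.linearMap S K)) (c / algebraMap R K x) = 0 ↔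
      ∃ u ∈ maximalIdeal R, algebraMap R K u = c := by
  rw [Subalgebra.mkQ_range_eq_zero_iff, h.mem_iff, mul_div_cancel₀ _ h.algebraMap_ne_zero]

/-- A homomorphism from the maximal ideal of `S` to `K ⧸ S` which kills `x` takes values in
`x⁻¹ S ⧸ S`. -/
theorem exists_lift_of_apply_eq_zero (h : MaximalIdealEqMul S x) [IsLocalRing S]
    (g : maximalIdeal S →ₗ[S] (K ⧸ LinearMap.range (Algebra.linearMap S K)))
    (hg : g ⟨algebraMap R S x, h.algebraMap_mem_maximalIdeal⟩ = 0) (a : maximalIdeal S) :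
    ∃ c ∈ S, g a =
      Submodule.mkQ (LinearMap.range (Algebra.linearMap S K)) (c / algebraMap R K x) := by
  obtain ⟨y, hy⟩ := Submodule.mkQ_surjective _ (g a)
  refine ⟨algebraMap R K x * y, ?_, ?_⟩
  · rw [← Subalgebra.mkQ_range_eq_zero_iff]
    have h1 : algebraMap R S x • g a = 0 := by
      rw [← map_smul, show algebraMap R S x • a =
        (a : S) • (⟨algebraMap R S x, h.algebraMap_mem_maximalIdeal⟩ : maximalIdeal S) from
        Subtype.ext (mul_comm _ _), map_smul, hg, smul_zero]
    rw [← hy, ← map_smul] at h1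
    exact h1
  · rw [mul_div_cancel_left₀ _ h.algebraMap_ne_zero]
    exact hy.symm

end MaximalIdealEqMul

end PrincipalOverring

/-! ### From K/S injective to R almost Gorenstein -/

section GorensteinOverring

variable {R : Type*} [CommRing R] [IsDomain R] [IsLocalRing R]
  {K : Type*} [Field K] [Algebra R K] [IsFractionRing R K]

/-- R is then Dedekind, so nonzero fractional ideals are invertible and ω = R is canonical. -/
theorem isAlmostGorenstein_of_isPrincipal [IsNoetherianRing R] (hR : ¬IsField R)
    (hm : (maximalIdeal R).IsPrincipal) : IsAlmostGorenstein R K := by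
  have hD : IsDedekindDomain R := ((IsDiscreteValuationRing.TFAE R hR).out 4 2).mp hm
  refine ⟨1, ⟨one_ne_zero, fun J _ => ?_⟩, le_rfl, ?_, (mul_one _).symm⟩
  · rw [one_div, one_div, inv_inv]
  · intro y hy
    obtain ⟨r, rfl⟩ := (FractionalIdeal.mem_one_iff R⁰).mp hy
    exact algebraMap_mem (integralClosure R K) r

/-- Let `𝔪 = x S` and let `R ⊆ ω ⊆ S` be such that `S ⧸ ω` is simple over `R` and every ideal of `S`
contained in `ω` is contained in `𝔪`. Then `ω` is a canonical ideal of `R`. -/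
theorem MaximalIdealEqMul.isCanonicalIdeal [IsNoetherianRing R] [Ring.KrullDimLE 1 R]
    {S : Subalgebra R K} {x : R} (h : MaximalIdealEqMul S x) {ω : FractionalIdeal R⁰ K}
    (hω1 : 1 ≤ ω) (hωS : ∀ y ∈ ω, y ∈ S) {s : K} (hs : s ∈ S)
    (hsimple : ∀ u ∈ S, ∃ r : R, u - r • s ∈ ω)
    (hfrob : ∀ b : K, (∀ a ∈ S, b * a ∈ ω) → ∃ u ∈ maximalIdeal R, algebraMap R K u = b) :
    IsCanonicalIdeal ω := by
  have hxK := h.algebraMap_ne_zero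
  have hRω := FractionalIdeal.algebraMap_mem_of_one_le hω1
  have hω0 : ω ≠ 0 := by
    rintro rfl
    have := hRω x
    rw [FractionalIdeal.mem_zero_iff] at this
    exact hxK this
  -- If 𝔪y ⊆ ω, then xy multiplies S into ω because xS = 𝔪, so xy ∈ 𝔪 = xS.
  have hdual : ∀ y : K, (∀ a ∈ maximalIdeal R, a • y ∈ (ω : Submodule R K)) → y ∈ S := by
    intro y hy
    obtain ⟨u, hu, hu'⟩ := hfrob (algebraMap R K x * y) fun a ha => by
      obtain ⟨v, hv, hv'⟩ := h.exists_mul_eq h.mem ha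
      rw [mul_right_comm, ← hv', ← Algebra.smul_def]
      exact hy v hv
    exact (h.mem_iff y).mpr ⟨u, hu, hu'⟩
  refine ⟨hω0, fun J hJ => ?_⟩
  obtain ⟨d, hd, hdJ⟩ := J.isFractional
  have hdK : algebraMap R K d ≠ 0 := by simpa using nonZeroDivisors.ne_zero hd
  have hD : ω / J ≠ 0 := by
    intro h0
    have : algebraMap R K d ∈ ω / J := by
      rw [FractionalIdeal.mem_div_iff_of_ne_zero hJ]
      intro j hj
      obtain ⟨r, hr⟩ := hdJ j hj
      rw [← Algebra.smul_def, ← hr]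
      exact hRω r
    rw [h0, FractionalIdeal.mem_zero_iff] at this
    exact hdK this
  apply le_antisymm
  swap
  · intro j hj
    rw [FractionalIdeal.mem_div_iff_of_ne_zero hD]
    intro y hy
    rw [mul_comm]
    exact (FractionalIdeal.mem_div_iff_of_ne_zero hJ).mp hy j hj
  obtain ⟨j, hjJ, hj0⟩ : ∃ j ∈ J, j ≠ 0 := by
    by_contra! hne
    exact hJ (FractionalIdeal.eq_zero_iff.mpr hne)
  -- The S-module jxS lies in J, is reflexive by `hfrob`, and contains a nonzero R-multiple of J.
  let I : Submodule R K := S.toSubmodule.map (LinearMap.mulLeft R (j * algebraMap R K x))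
  have hIJ : I ≤ (J : Submodule R K) := by
    rintro _ ⟨a, ha, rfl⟩
    obtain ⟨v, -, hv⟩ := h.exists_mul_eq h.mem ha
    rw [LinearMap.mulLeft_apply, mul_assoc, ← hv, mul_comm, ← Algebra.smul_def]
    exact Submodule.smul_mem _ v hjJ
  have hI : (ω : Submodule R K) / (ω / I) ≤ I := by
    intro z hz
    simp only [Submodule.mem_div_iff_forall_mul_mem] at hz
    obtain ⟨u, hu, hu'⟩ := hfrob (z * j⁻¹) fun a ha => by
      rw [mul_assoc]
      refine hz _ ?_
      rintro _ ⟨b, hb, rfl⟩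
      rw [LinearMap.mulLeft_apply,
        show j⁻¹ * a * (j * algebraMap R K x * b) = algebraMap R K x * (a * b) by field_simp]
      exact h.mul_mem_of_one_le hω1 h.mem (mul_mem ha hb)
    have hzS : z * j⁻¹ / algebraMap R K x ∈ S :=
      (h.mem_iff _).mpr ⟨u, hu, by rw [hu']; field_simp⟩
    refine ⟨_, hzS, ?_⟩
    rw [LinearMap.mulLeft_apply]
    field_simp
  obtain ⟨p, q, hq, hpq⟩ := IsFractionRing.div_surjective (A := R) (j * algebraMap R K x)
  have hqK : algebraMap R K q ≠ 0 := by simpa using nonZeroDivisors.ne_zero hq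
  have hp : p ≠ 0 := by
    rintro rfl
    rw [map_zero, zero_div] at hpq
    exact mul_ne_zero hj0 hxK hpq.symm
  have hnoeth : IsNoetherian R (J : Submodule R K) := FractionalIdeal.isNoetherian J
  have key := Submodule.div_div_le_of_simple (ω : Submodule R K) (fun u v hu hv hvω => by
      obtain ⟨r₁, hr₁⟩ := hsimple u (hdual u hu)
      obtain ⟨r₂, hr₂⟩ := hsimple v (hdual v hv)
      have hr₂u : IsUnit r₂ := by
        by_contra hn
        refine hvω ?_
        have := add_mem (S := Submodule R K) hr₂
          (show r₂ • s ∈ (ω : Submodule R K) from (Algebra.smul_def r₂ s).symm ▸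
            h.mul_mem_of_one_le hω1 ((mem_maximalIdeal _).mpr hn) hs)
        rwa [sub_add_cancel] at this
      obtain ⟨r₃, hr₃⟩ := hr₂u.exists_left_inv
      refine ⟨r₁ * r₃, ?_⟩
      have hsum := sub_mem (S := Submodule R K) hr₁
        (Submodule.smul_mem (ω : Submodule R K) (r₁ * r₃) hr₂)
      convert hsum using 1
      rw [smul_sub, smul_smul (r₁ * r₃) r₂, mul_assoc, hr₃, mul_one]
      ring) hIJ hI (r := p * d) (mul_ne_zero hp (nonZeroDivisors.ne_zero hd)) (fun i hi => by
      obtain ⟨r, hr⟩ := hdJ i hi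
      refine ⟨algebraMap R K (r * q), S.algebraMap_mem _, ?_⟩
      rw [LinearMap.mulLeft_apply, mul_smul, ← hr, ← hpq, Algebra.smul_def, map_mul]
      field_simp)
  intro z hz
  refine key ?_
  rw [← FractionalIdeal.coe_div hJ, ← FractionalIdeal.coe_div hD]
  exact hz

variable [IsNoetherianRing R] [Ring.KrullDimLE 1 R]

/-- Let `𝔪 = x S` with `S` local and residually rational. If `K ⧸ S` is injective over `S`, then `R`
is almost Gorenstein. -/
theorem MaximalIdealEqMul.isAlmostGorenstein_of_baer {S : Subalgebra R K} {x : R}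
    (h : MaximalIdealEqMul S x) [IsLocalRing S] (hR : ¬IsField R)
    (hrat : ∀ a : S, ∃ r : R, a - algebraMap R S r ∈ maximalIdeal S)
    (hE : Module.Baer S (K ⧸ LinearMap.range (Algebra.linearMap S K))) :
    IsAlmostGorenstein R K := by
  have := h.isNoetherianRing
  have := h.krullDimLE_one
  have := h.finite
  set X : S := algebraMap R S x with hX
  have hX0 : X ≠ 0 := by
    intro h0
    exact h.algebraMap_ne_zero (congrArg Subtype.val h0)
  have hone : (1 : S) ∉ Ideal.span {X} := by
    simpa using h.algebraMap_notMem_span_of_isUnit isUnit_one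
  obtain ⟨s, hs, hns⟩ := exists_smul_notMem_and_maximalIdeal_smul_mem (Ideal.span {X})
    (z := (1 : S)) hone hX0 (by simp)
  simp only [smul_eq_mul, mul_one] at hs hns
  -- If s comes from R it is a unit, so the maximal ideal of S lies in xS = 𝔪. Residual rationality
  -- then gives S = R and 𝔪 = xR.
  by_cases hsR : ∃ r : R, algebraMap R S r = s
  · obtain ⟨r, rfl⟩ := hsR
    have hr : IsUnit r := by
      by_contra hn
      exact hs ((h.mem_span_iff _).mpr ⟨r, (mem_maximalIdeal _).mpr hn, rfl⟩)
    have hn : ∀ a ∈ maximalIdeal S, ∃ u ∈ maximalIdeal R, algebraMap R K u = a := by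
      intro a ha
      rw [← h.mem_span_iff]
      exact (Ideal.mul_unit_mem_iff_mem _ (hr.map (algebraMap R S))).mp (hns a ha)
    have hSR : ∀ a ∈ S, ∃ r : R, algebraMap R K r = a := by
      intro a ha
      obtain ⟨r, hr⟩ := hrat ⟨a, ha⟩
      obtain ⟨u, -, hu⟩ := hn _ hr
      refine ⟨u + r, ?_⟩
      rw [map_add, hu]
      exact sub_add_cancel a _
    refine isAlmostGorenstein_of_isPrincipal hR ⟨x, le_antisymm (fun u hu => ?_) ?_⟩
    · have hxK := h.algebraMap_ne_zero
      obtain ⟨r, hr⟩ := hSR (algebraMap R K u / algebraMap R K x)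
        ((h.mem_iff _).mpr ⟨u, hu, by field_simp⟩)
      rw [Ideal.submodule_span_eq, Ideal.mem_span_singleton']
      refine ⟨r, IsFractionRing.injective R K ?_⟩
      rw [map_mul, hr]
      field_simp
    · rw [Ideal.submodule_span_eq, Ideal.span_singleton_le_iff_mem]
      exact h.mem
  obtain ⟨W, ⟨hW1, hWs⟩, hmax⟩ := WellFounded.has_min (wellFounded_gt (α := Submodule R S))
    {W | 1 ∈ W ∧ s ∉ W} ⟨1, Submodule.one_le.mp le_rfl, fun hmem =>
      hsR (Submodule.mem_one.mp hmem)⟩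
  have hWR : ∀ r : R, algebraMap R S r ∈ W := fun r => by
    rw [Algebra.algebraMap_eq_smul_one]; exact W.smul_mem r hW1
  have hWX : ∀ a ∈ Ideal.span {X}, a ∈ W := by
    intro a ha
    obtain ⟨u, -, hu⟩ := (h.mem_span_iff a).mp ha
    have : algebraMap R S u = a := Subtype.ext hu
    exact this ▸ hWR u
  have hsimple : ∀ u : S, ∃ r : R, u - r • s ∈ W := by
    intro u
    by_cases hu : u ∈ W
    · exact ⟨0, by simpa using hu⟩
    have hsW : s ∈ W ⊔ Submodule.span R {u} := by
      by_contra hsW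
      refine hmax _ ⟨Submodule.mem_sup_left hW1, hsW⟩ (lt_of_le_of_ne le_sup_left fun h' => hu ?_)
      rw [h']; exact Submodule.mem_sup_right (Submodule.mem_span_singleton_self u)
    obtain ⟨w, hw, _, hv, hwv⟩ := Submodule.mem_sup.mp hsW
    obtain ⟨r, rfl⟩ := Submodule.mem_span_singleton.mp hv
    have hr : IsUnit r := by
      by_contra hn
      refine hWs (hwv ▸ add_mem hw (hWX _ ((h.mem_span_iff _).mpr ?_)))
      obtain ⟨v, hv, hv'⟩ := h.exists_mul_eq ((mem_maximalIdeal _).mpr hn) u.2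
      exact ⟨v, hv, hv'.trans (Algebra.smul_def r (u : K)).symm⟩
    obtain ⟨t, ht⟩ := hr.exists_left_inv
    refine ⟨t, ?_⟩
    rw [← hwv, smul_add, smul_smul, ht, one_smul, sub_add_cancel_right]
    exact neg_mem (W.smul_mem t hw)
  have hfrob : ∀ b : S, (∀ a : S, b * a ∈ W) → b ∈ Ideal.span {X} := by
    intro b hb
    by_contra hbX
    -- Some cb is a nonzero socle element modulo x, so s ∈ xS + cbS ⊆ W, a contradiction.
    obtain ⟨c, hc, hnc⟩ := exists_smul_notMem_and_maximalIdeal_smul_mem (Ideal.span {X})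
      hbX hX0 (Ideal.mul_mem_right _ _ (Ideal.mem_span_singleton_self X))
    simp only [smul_eq_mul] at hc hnc
    obtain ⟨_, hv, _, hw, hvw⟩ := Submodule.mem_sup.mp (mem_sup_span_of_baer K hE hX0 hc hnc hns)
    obtain ⟨d, rfl⟩ := Ideal.mem_span_singleton'.mp hw
    refine hWs (hvw ▸ add_mem (hWX _ hv) ?_)
    rw [← mul_assoc, mul_comm]
    exact hb _
  have hfrac : IsFractional R⁰ (W.map S.val.toLinearMap) := h.isFractional (by
    rintro _ ⟨w, -, rfl⟩
    exact w.2)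
  let ω : FractionalIdeal R⁰ K := ⟨W.map S.val.toLinearMap, hfrac⟩
  have hωW : ∀ a : S, (a : K) ∈ ω ↔ a ∈ W := by
    intro a
    constructor
    · rintro ⟨w, hw, hw'⟩
      have : w = a := Subtype.ext hw'
      exact this ▸ hw
    · exact fun ha => ⟨a, ha, rfl⟩
  have hωS : ∀ y ∈ ω, y ∈ S := by
    rintro _ ⟨w, -, rfl⟩
    exact w.2
  have hω1 : 1 ≤ ω := FractionalIdeal.one_le.mpr ((hωW 1).mpr hW1)
  refine ⟨ω, h.isCanonicalIdeal hω1 hωS s.2 (fun u hu => ?_) (fun b hb => ?_), hω1,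
    fun y hy => h.le_integralClosure (hωS y hy), ?_⟩
  · obtain ⟨r, hr⟩ := hsimple ⟨u, hu⟩
    exact ⟨r, (hωW _).mpr hr⟩
  · have hbS : b ∈ S := hωS b (by simpa using hb 1 S.one_mem)
    exact (h.mem_span_iff ⟨b, hbS⟩).mp (hfrob ⟨b, hbS⟩ fun a => (hωW _).mp (hb a a.2))
  · apply le_antisymm
    · calc (maximalIdeal R : FractionalIdeal R⁰ K) = maximalIdeal R * 1 := (mul_one _).symm
        _ ≤ maximalIdeal R * ω := by gcongr
    · rw [FractionalIdeal.mul_le]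
      intro i hi j hj
      obtain ⟨u, hu, rfl⟩ := (FractionalIdeal.mem_coeIdeal R⁰).mp hi
      obtain ⟨v, hv, hv'⟩ := h.exists_mul_eq hu (hωS j hj)
      exact (FractionalIdeal.mem_coeIdeal R⁰).mpr ⟨v, hv, hv'⟩

end GorensteinOverring

/-! ### From R almost Gorenstein to K/S injective -/

section CanonicalOverring

variable {R : Type*} [CommRing R] [IsDomain R] {K : Type*} [Field K] [Algebra R K]
  [IsFractionRing R K]

/-- A canonical ideal `ω` satisfies `ω : ω = R`. -/
theorem IsCanonicalIdeal.exists_algebraMap_eq {ω : FractionalIdeal R⁰ K} (hω : IsCanonicalIdeal ω)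
    {y : K} (hy : ∀ w ∈ ω, y * w ∈ ω) : ∃ r : R, algebraMap R K r = y := by
  have : y ∈ (1 : Submodule R K) := by
    have hfrac : IsFractional R⁰ (1 : Submodule R K) := by
      rw [← FractionalIdeal.coe_one (S := R⁰)]
      exact (1 : FractionalIdeal R⁰ K).isFractional
    refine hω.mem_of_forall hfrac ⟨1, Submodule.one_le.mp le_rfl, one_ne_zero⟩ fun z hz => ?_
    rw [mul_comm]
    exact hy z (by simpa using hz 1 (Submodule.one_le.mp le_rfl))
  exact Submodule.mem_one.mp this

variable [IsLocalRing R]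

namespace MaximalIdealEqMul

variable {S : Subalgebra R K} {x : R} {ω : FractionalIdeal R⁰ K}

/-- If `R ⊆ ω ⊊ S` with `ω` canonical, then `ω : S ⊆ 𝔪`. -/
theorem exists_mem_maximalIdeal_of_forall_mul_mem (hω : IsCanonicalIdeal ω)
    (hωS : ∀ y ∈ ω, y ∈ S) (hne : ∃ y ∈ S, y ∉ ω) {c : K} (hc : ∀ a ∈ S, c * a ∈ ω) :
    ∃ u ∈ maximalIdeal R, algebraMap R K u = c := by
  obtain ⟨y, hyS, hy⟩ := hne
  obtain ⟨r, rfl⟩ := hω.exists_algebraMap_eq fun w hw => hc w (hωS w hw)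
  exact ⟨r, FractionalIdeal.mem_maximalIdeal_of_algebraMap_mul_mem hy (hc y hyS), rfl⟩

/-- If `R ⊆ ω ⊊ S` with `ω` canonical and `𝔪 = x S`, then `ω : 𝔪 ⊆ S`. -/
theorem mem_of_forall_mul_algebraMap_mem (h : MaximalIdealEqMul S x) (hω : IsCanonicalIdeal ω)
    (hωS : ∀ y ∈ ω, y ∈ S) (hne : ∃ y ∈ S, y ∉ ω) {y : K}
    (hy : ∀ u ∈ maximalIdeal R, y * algebraMap R K u ∈ ω) : y ∈ S := by
  refine hω.mem_of_forall (J := Subalgebra.toSubmodule S) (h.isFractional fun j hj => hj)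
    ⟨1, S.one_mem, one_ne_zero⟩ fun z hz => ?_
  obtain ⟨u, hu, rfl⟩ := exists_mem_maximalIdeal_of_forall_mul_mem hω hωS hne hz
  rw [mul_comm]
  exact hy u hu

/-- If `R ⊆ ω ⊆ S` with `ω` canonical and `𝔪 = x S`, then every nonzero element generates the
`R`-module `S ⧸ ω`. -/
theorem exists_sub_algebraMap_mul_mem (h : MaximalIdealEqMul S x) (hω : IsCanonicalIdeal ω)
    (hω1 : 1 ≤ ω) (hωS : ∀ y ∈ ω, y ∈ S) {u v : K} (hu : u ∈ S) (hv : v ∈ S) (hvω : v ∉ ω) :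
    ∃ r : R, u - algebraMap R K r * v ∈ ω := by
  -- An element multiplying ω + Rv into ω lies in ω : ω = R, and in 𝔪 because v ∉ ω; so it
  -- multiplies u ∈ S into ω.
  have : u ∈ (ω : Submodule R K) ⊔ Submodule.span R {v} := by
    refine hω.mem_of_forall (h.isFractional fun j hj => ?_)
      ⟨1, Submodule.mem_sup_left (FractionalIdeal.one_le.mp hω1), one_ne_zero⟩ fun y hy => ?_
    · have hle : (ω : Submodule R K) ⊔ Submodule.span R {v} ≤ Subalgebra.toSubmodule S :=
        sup_le hωS (by simpa [Submodule.span_le] using hv)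
      exact hle hj
    · obtain ⟨r, rfl⟩ := hω.exists_algebraMap_eq fun w hw => hy w (Submodule.mem_sup_left hw)
      exact h.mul_mem_of_one_le hω1 (FractionalIdeal.mem_maximalIdeal_of_algebraMap_mul_mem hvω
        (hy v (Submodule.mem_sup_right (Submodule.mem_span_singleton_self v)))) hu
  obtain ⟨w, hw, _, hv', hwv⟩ := Submodule.mem_sup.mp this
  obtain ⟨r, rfl⟩ := Submodule.mem_span_singleton.mp hv'
  refine ⟨r, ?_⟩
  rw [← hwv, ← Algebra.smul_def, add_sub_cancel_right]
  exact hw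

set_option maxHeartbeats 1000000 in
/-- If `R ⊆ ω ⊊ S` with `ω` canonical and `𝔪 = x S`, then every homomorphism from the maximal ideal
of `S` to `K ⧸ S` which kills `x` is a multiplication. -/
theorem exists_eq_mkQ_mul (h : MaximalIdealEqMul S x) [IsLocalRing S]
    (hω : IsCanonicalIdeal ω) (hω1 : 1 ≤ ω) (hωS : ∀ y ∈ ω, y ∈ S) (hne : ∃ y ∈ S, y ∉ ω)
    (g : maximalIdeal S →ₗ[S] (K ⧸ LinearMap.range (Algebra.linearMap S K)))
    (hg : g ⟨algebraMap R S x, h.algebraMap_mem_maximalIdeal⟩ = 0) :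
    ∃ e : K, ∀ a, g a =
      Submodule.mkQ (LinearMap.range (Algebra.linearMap S K)) ((a : S) * e) := by
  choose γ hγS hγ using h.exists_lift_of_apply_eq_zero g hg
  set q := Submodule.mkQ (LinearMap.range (Algebra.linearMap S K))
  have hlift : ∀ (a : maximalIdeal S) (c : K), g a = q (c / algebraMap R K x) → γ a - c ∈ ω := by
    intro a c hc
    obtain ⟨u, -, hu⟩ := (h.mkQ_range_div_eq_zero_iff (γ a - c)).mp (by
      rw [sub_div, map_sub]
      exact sub_eq_zero.mpr ((hγ a).symm.trans hc))
    exact hu ▸ FractionalIdeal.algebraMap_mem_of_one_le hω1 u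
  have hqsmul : ∀ (l : S) (c : K), l • q (c / algebraMap R K x) = q (l * c / algebraMap R K x) :=
    fun l c => by rw [← map_smul, mul_div_assoc]; rfl
  have hγsmul : ∀ (l : S) (a : maximalIdeal S), γ (l • a) - l * γ a ∈ ω := fun l a =>
    hlift _ _ (by rw [map_smul, hγ a, hqsmul])
  have hγadd : ∀ a b : maximalIdeal S, γ (a + b) - (γ a + γ b) ∈ ω := fun a b =>
    hlift _ _ (by rw [map_add, hγ a, hγ b, add_div, map_add])
  have hγsub : ∀ (r : R) (a b : maximalIdeal S),
      γ (a - algebraMap R S r • b) - (γ a - algebraMap R K r * γ b) ∈ ω := fun r a b =>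
    hlift _ _ (by rw [map_sub, map_smul, hγ a, hγ b, hqsmul, sub_div, map_sub]; rfl)
  have hmod : ∀ {y z : K}, y - z ∈ ω → z ∈ ω → y ∈ ω := fun {y z} hyz hz => by
    have := add_mem (S := Submodule R K) (s := (ω : Submodule R K)) hyz hz
    rwa [sub_add_cancel] at this
  -- Agreement modulo ω suffices: applied to all la with l ∈ S, it puts γ a − ba in ω : S ⊆ 𝔪 = xS.
  have hfinish : ∀ b : K, (∀ a : maximalIdeal S, γ a - b * (a : S) ∈ ω) →
      ∃ e : K, ∀ a, g a = q ((a : S) * e) := by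
    intro b hb
    refine ⟨b / algebraMap R K x, fun a => ?_⟩
    rw [hγ a, ← sub_eq_zero, ← map_sub, mul_div_assoc', ← sub_div, h.mkQ_range_div_eq_zero_iff]
    refine exists_mem_maximalIdeal_of_forall_mul_mem hω hωS hne fun l hl => ?_
    have h2 := sub_mem (S := Submodule R K) (H := (ω : Submodule R K))
      (hb ((⟨l, hl⟩ : S) • a)) (hγsmul ⟨l, hl⟩ a)
    have h3 : (γ a - (a : S) * b) * l = γ ((⟨l, hl⟩ : S) • a) - b * (l * (a : S)) -
        (γ ((⟨l, hl⟩ : S) • a) - l * γ a) := by ring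
    rw [h3]
    exact h2
  by_cases hall : ∀ a, γ a ∈ ω
  · exact hfinish 0 fun a => by simpa using hall a
  push Not at hall
  obtain ⟨a₀, ha₀⟩ := hall
  -- H is the kernel of the R-linear map a ↦ γ a mod ω.
  let H : Submodule R K :=
    { carrier := {z | ∃ a : maximalIdeal S, γ a ∈ ω ∧ ((a : S) : K) = z}
      zero_mem' := ⟨0, by simpa using hlift 0 0 (by simp), rfl⟩
      add_mem' := by
        rintro _ _ ⟨a, ha, rfl⟩ ⟨b, hb, rfl⟩
        exact ⟨a + b, hmod (hγadd a b) (add_mem (S := Submodule R K) ha hb), rfl⟩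
      smul_mem' := by
        rintro r _ ⟨a, ha, rfl⟩
        exact ⟨algebraMap R S r • a, hmod (hγsmul _ a) (FractionalIdeal.algebraMap_mul_mem r ha),
          (Algebra.smul_def r _).symm⟩ }
  have hHm : ∀ u ∈ maximalIdeal R, algebraMap R K u ∈ H := by
    intro u hu
    obtain ⟨c, hc⟩ := Ideal.mem_span_singleton'.mp
      ((h.mem_span_iff (algebraMap R S u)).mpr ⟨u, hu, rfl⟩)
    refine ⟨c • ⟨algebraMap R S x, h.algebraMap_mem_maximalIdeal⟩, ?_, congrArg Subtype.val hc⟩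
    simpa using hlift (c • ⟨algebraMap R S x, h.algebraMap_mem_maximalIdeal⟩) 0 (by
      rw [map_smul, hg, smul_zero, zero_div, map_zero])
  have ha₀H : ((a₀ : S) : K) ∉ H := by
    rintro ⟨a, ha, haa⟩
    have : a = a₀ := Subtype.ext (Subtype.ext haa)
    exact ha₀ (this ▸ ha)
  -- By duality some a ↦ ba mod ω also kills H but not a₀. Since S/ω is simple, γ is congruent to ρ
  -- times this map.
  obtain ⟨b, hbH, hba₀⟩ : ∃ b : K, (∀ j ∈ H, b * j ∈ ω) ∧ b * ((a₀ : S) : K) ∉ ω := by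
    by_contra! hcon
    refine ha₀H (hω.mem_of_forall (h.isFractional ?_) ⟨_, hHm x h.mem, h.algebraMap_ne_zero⟩ hcon)
    rintro _ ⟨a, -, rfl⟩
    exact (a : S).2
  have hbS : b ∈ S :=
    h.mem_of_forall_mul_algebraMap_mem hω hωS hne fun u hu => hbH _ (hHm u hu)
  obtain ⟨ρ, hρ⟩ := h.exists_sub_algebraMap_mul_mem hω hω1 hωS (hγS a₀)
    (mul_mem hbS (a₀ : S).2) hba₀
  refine hfinish (algebraMap R K ρ * b) fun a => ?_
  obtain ⟨r, hr⟩ := h.exists_sub_algebraMap_mul_mem hω hω1 hωS (hγS a) (hγS a₀) ha₀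
  have hmemH : ((a : S) : K) - algebraMap R K r * (a₀ : S) ∈ H :=
    ⟨a - algebraMap R S r • a₀, hmod (hγsub r a a₀) hr, rfl⟩
  have h3 : γ a - algebraMap R K ρ * b * (a : S) = γ a - algebraMap R K r * γ a₀ +
      algebraMap R K r * (γ a₀ - algebraMap R K ρ * (b * (a₀ : S))) -
      algebraMap R K ρ * (b * ((a : S) - algebraMap R K r * (a₀ : S))) := by ring
  rw [h3]
  exact sub_mem (S := Submodule R K) (add_mem (S := Submodule R K) hr
    (FractionalIdeal.algebraMap_mul_mem r hρ)) (FractionalIdeal.algebraMap_mul_mem ρ (hbH _ hmemH))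

/-- Let `𝔪 = x S` with `S` local. If `R` is almost Gorenstein, then `K ⧸ S` is injective over
`S`. -/
theorem baer_of_isAlmostGorenstein [IsNoetherianRing R] [Ring.KrullDimLE 1 R]
    (h : MaximalIdealEqMul S x) [IsLocalRing S] (hAG : IsAlmostGorenstein R K) :
    Module.Baer S (K ⧸ LinearMap.range (Algebra.linearMap S K)) := by
  have := h.isNoetherianRing
  have := h.krullDimLE_one
  obtain ⟨ω, hω, hω1, -, hmω⟩ := hAG
  let X : maximalIdeal S := ⟨algebraMap R S x, h.algebraMap_mem_maximalIdeal⟩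
  let q := Submodule.mkQ (LinearMap.range (Algebra.linearMap S K))
  have hωS : ∀ y ∈ ω, y ∈ S := by
    intro y hy
    rw [h.mem_iff]
    have : algebraMap R K x * y ∈ (maximalIdeal R : FractionalIdeal R⁰ K) := by
      rw [hmω]
      exact FractionalIdeal.mul_mem_mul
        ((FractionalIdeal.mem_coeIdeal R⁰).mpr ⟨x, h.mem, rfl⟩) hy
    exact (FractionalIdeal.mem_coeIdeal R⁰).mp this
  have hmain : ∀ g : maximalIdeal S →ₗ[S] (K ⧸ LinearMap.range (Algebra.linearMap S K)),
      g X = 0 → ∃ e : K, ∀ a, g a = q ((a : S) * e) := by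
    intro g hg
    by_cases hSω : ∃ y ∈ S, y ∉ ω
    · exact h.exists_eq_mkQ_mul hω hω1 hωS hSω g hg
    push Not at hSω
    -- Here ω = S, so S ⊆ ω : ω = R; the maximal ideal of S is then xS, where g vanishes.
    refine ⟨0, fun a => ?_⟩
    obtain ⟨r, hr⟩ := hω.exists_algebraMap_eq (y := ((a : S) : K)) fun w hw =>
      hSω _ (mul_mem (a : S).2 (hωS w hw))
    have hrm : r ∈ maximalIdeal R := by
      rw [mem_maximalIdeal, mem_nonunits_iff]
      intro hu
      refine a.2 ?_
      have : algebraMap R S r = a := Subtype.ext hr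
      exact this ▸ hu.map (algebraMap R S)
    obtain ⟨c, hc⟩ := Ideal.mem_span_singleton'.mp ((h.mem_span_iff _).mpr ⟨r, hrm, hr⟩)
    have : a = c • X := Subtype.ext hc.symm
    rw [this, map_smul, hg, smul_zero, mul_zero, map_zero]
  refine Module.Baer.of_maximalIdeal fun g => ?_
  obtain ⟨e₀, he₀⟩ := Submodule.mkQ_surjective _ (g X)
  -- Subtracting multiplication by e₀/x reduces to a map that kills x.
  let μ : maximalIdeal S →ₗ[S] (K ⧸ LinearMap.range (Algebra.linearMap S K)) :=
    LinearMap.toSpanSingleton S _ (q (e₀ / algebraMap R K x)) ∘ₗ (maximalIdeal S).subtype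
  have hμ : ∀ a, μ a = q ((a : S) * (e₀ / algebraMap R K x)) := fun a => rfl
  obtain ⟨e, he⟩ := hmain (g - μ) (by
    rw [LinearMap.sub_apply, hμ, ← he₀, sub_eq_zero]
    exact congrArg q (mul_div_cancel₀ e₀ h.algebraMap_ne_zero).symm)
  refine ⟨q (e + e₀ / algebraMap R K x), fun a => ?_⟩
  have hea := he a
  rw [LinearMap.sub_apply, sub_eq_iff_eq_add, hμ, ← map_add, ← mul_add] at hea
  exact hea

end MaximalIdealEqMul

end CanonicalOverring

theorem proposition6p3 (R : Type*) [CommRing R] [IsDomain R] [IsLocalRing R] [IsNoetherianRing R]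
    (hdim : ringKrullDim R = 1) [Infinite (ResidueField R)]
    (K : Type*) [Field K] [Algebra R K] [IsFractionRing R K]
    [Module.Finite R (integralClosure R K)] [IsDiscreteValuationRing (integralClosure R K)]
    (hres : Function.Surjective (algebraMap R (ResidueField (integralClosure R K))))
    (hstable : IsStableMaximalIdeal R K) :
    IsAlmostGorenstein R K ↔ IsGorensteinLocalRing (blowUp R K (maximalIdeal R)) := by
  have hR : ¬IsField R := (ringKrullDim_eq_one_iff_of_isLocalRing_isDomain.mp hdim).1
  have : Ring.KrullDimLE 1 R := Ring.krullDimLE_iff.mpr hdim.le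
  obtain ⟨x, hx, hx0, hS⟩ := hstable.exists_mem_blowUp_iff hR
  have h : MaximalIdealEqMul (blowUp R K (maximalIdeal R)) x := ⟨hx, hx0, hS⟩
  have hnoeth := h.isNoetherianRing
  have := h.krullDimLE_one
  constructor
  · intro hAG
    have hloc := h.isLocalRing
    exact ⟨hnoeth, hloc,
      (exists_hasInjectiveDimensionLE_iff_baer K).mpr (h.baer_of_isAlmostGorenstein hAG)⟩
  · rintro ⟨-, hloc, hinj⟩
    exact h.isAlmostGorenstein_of_baer hR (h.exists_sub_algebraMap_mem hres)
      ((exists_hasInjectiveDimensionLE_iff_baer K).mp hinj)
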